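/- Let $\mathbb{T}^2=(\mathbb{R}/\mathbb{Z})^2$ and $\Gamma=SL(2,\mathbb{Z})$, where $\gamma=\begin{pmatrix}a&b\\c&d\end{pmatrix}\in\Gamma$ acts on $\mathbb{T}^2$ by $\gamma\cdot(\epsilon_0,\epsilon_1)=(a\epsilon_0-b\epsilon_1,\,-c\epsilon_0+d\epsilon_1)$. Put $A=\mathbb{T}^2\rtimes\Gamma$ and $A^{(3)}=A^3\rtimes S_3$, with $S_3$ permuting the three factors. Let $V\subset\mathbb{T}^2$ be the subgroup of points of order dividing $2$, and identify $\mathbb{Z}/2$ with $\{\pm I\}\subset\Gamma$, so that $(V\times\mathbb{Z}/2)^3\subset A^3\subset A^{(3)}$. Let $$K=\mathrm{Ker}\big((\mathbb{Z}/2)^3\xrightarrow{\ \mathrm{sum}\ }\mathbb{Z}/2\big),\qquad G_{max}=\mathrm{Ker}\big((V\times\mathbb{Z}/2)^3\to(\mathbb{Z}/2)^3\xrightarrow{\ \mathrm{sum}\ }\mathbb{Z}/2\big).$$ Let $G$ be any subgroup of $G_{max}$ whose image under the projection to $(\mathbb{Z}/2)^3$ is all of $K$. Let $H=N_{A^{(3)}}(G)$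 be the normalizer of $G$ in $A^{(3)}$ and $H'=H/G$. Then the group cohomology $H^2(H',\mathbb{Z})$, with $H'$ regarded as a discrete group acting trivially on $\mathbb{Z}$, is a finitely generated abelian group. -/

import Mathlib

namespace ToroidalOrbifold

open Matrix

/-- The real torus `T² = (ℝ/ℤ)²`. -/
abbrev Torus : Type := UnitAddCircle × UnitAddCircle

/-- `γ = (a b; c d)` acts on `T²` by `(ε₀, ε₁) ↦ (a ε₀ - b ε₁, -c ε₀ + d ε₁)`.  This is conjugation
by `γ` on translations `(τ, z) ↦ (τ, z + ε₀ + ε₁ τ)` of the universal elliptic curve, where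
`γ • (τ, z) = ((a τ + b) / (c τ + d), (c τ + d)⁻¹ z)`. -/
def torusAct (γ : SpecialLinearGroup (Fin 2) ℤ) (ε : Torus) : Torus :=
  (γ 0 0 • ε.1 - γ 0 1 • ε.2, -(γ 1 0 • ε.1) + γ 1 1 • ε.2)

theorem torusAct_one (ε : Torus) : torusAct 1 ε = ε := by
  simp [torusAct]

theorem torusAct_mul (γ δ : SpecialLinearGroup (Fin 2) ℤ) (ε : Torus) :
    torusAct (γ * δ) ε = torusAct γ (torusAct δ ε) := by
  have h : ∀ i j, (γ * δ) i j = γ i 0 * δ 0 j + γ i 1 * δ 1 j := fun i j => by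
    change (γ.1 * δ.1) i j = _
    rw [Matrix.mul_apply, Fin.sum_univ_two]
  ext <;> simp only [torusAct, h] <;> module

theorem torusAct_add (γ : SpecialLinearGroup (Fin 2) ℤ) (ε ε' : Torus) :
    torusAct γ (ε + ε') = torusAct γ ε + torusAct γ ε' := by
  ext <;> simp only [torusAct, Prod.fst_add, Prod.snd_add] <;> module

/-- The action of `Γ = SL(2, ℤ)` on `T²` by group automorphisms (`T²` written multiplicatively). -/
def torusHom : SpecialLinearGroup (Fin 2) ℤ →* MulAut (Multiplicative Torus) where
  toFun γ :=
    { toFun := fun ε => Multiplicative.ofAdd (torusAct γ ε.toAdd)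
      invFun := fun ε => Multiplicative.ofAdd (torusAct γ⁻¹ ε.toAdd)
      left_inv := fun ε => by simp [← torusAct_mul, torusAct_one]
      right_inv := fun ε => by simp [← torusAct_mul, torusAct_one]
      map_mul' := fun ε ε' => by simp [torusAct_add] }
  map_one' := by ext ε : 1; simp [torusAct_one]
  map_mul' γ δ := by ext ε : 1; simp [torusAct_mul]

/-- `A = (ℝ/ℤ)² ⋊ SL(2, ℤ)`. -/
abbrev A : Type := Multiplicative Torus ⋊[torusHom] SpecialLinearGroup (Fin 2) ℤ

/-- `A⁽³⁾ = A³ ⋊ S₃`, where `σ ∈ S₃` acts on `A³` by `(σ • a) i = a (σ⁻¹ i)`. -/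
abbrev A3 : Type :=
  (Fin 3 → A) ⋊[mulAutArrow (G := Equiv.Perm (Fin 3)) (A := Fin 3) (M := A)] Equiv.Perm (Fin 3)

/-- The element `±I` of `SL(2, ℤ)` attached to a sign: inversion `z ↦ -z` when the sign is `-1`. -/
def signMatrix (s : ℤˣ) : SpecialLinearGroup (Fin 2) ℤ :=
  if s = 1 then 1 else -1

/-- `g ∈ A⁽³⁾` has twist `s ∈ {±1}³`: it is `(ε, (s₁ I, s₂ I, s₃ I), 1)` with each `εᵢ ∈ T²` a
point of order dividing `2`. -/
structure HasTwist (g : A3) (s : Fin 3 → ℤˣ) : Prop where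
  perm : g.right = 1
  twist : ∀ i, (g.left i).right = signMatrix (s i)
  shift : ∀ i, (2 : ℕ) • (g.left i).left.toAdd = 0

/-- `G` is an admissible orbifold group: a subgroup of
`G_max = Ker ((V × ℤ/2)³ → (ℤ/2)³ → ℤ/2) ⊆ A⁽³⁾` (`V` being the points of order dividing `2` in
`T²`, and `ℤ/2 = {±I}`) that maps onto `Ker ((ℤ/2)³ → ℤ/2)`. -/
structure IsOrbifoldGroup (G : Subgroup A3) : Prop where
  le_max : ∀ g ∈ G, ∃ s : Fin 3 → ℤˣ, ∏ i, s i = 1 ∧ HasTwist g s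
  surj : ∀ s : Fin 3 → ℤˣ, ∏ i, s i = 1 → ∃ g ∈ G, HasTwist g s

/-- `H`, the normalizer of `G` in `A⁽³⁾`. -/
abbrev H (G : Subgroup A3) : Subgroup A3 := Subgroup.normalizer (G : Set A3)

/-- `H' = H / G`. -/
abbrev H' (G : Subgroup A3) : Type := H G ⧸ G.subgroupOf (H G)

end ToroidalOrbifold

/-! For a finitely presented group, $H^2(-,\mathbb{Z})$ is finitely generated: a 2-cocycle vanishing
on a suitable finite set `P` of pairs defines a central extension whose tautological section
respects the products in `P`. Hence the extension splits and the cocycle is a coboundary, so $H^2$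
is a quotient of a subgroup of $\mathbb{Z}^P$ (`FinitelyTestedHoms.fg_H2`).

Finite presentability holds for free groups and passes to finite powers and to overgroups of finite
index. It therefore suffices to embed $F_2^3$ in $H'$ with finite index. The Sanov subgroup of
$\Gamma$ is free of rank two, has finite index, and is trivial mod 2, so its cube centralizes
$G_{max}$ and lies in $H$. It has finite index there because normalizing $G$ forces translation
parts to be 4-torsion. It meets $G$ trivially because $-I$ is not in the Sanov subgroup. -/

/-! ### Finite presentability and its permanence properties -/

/-- `G` is generated by a finite set `S`, and there are finitely many products in `G` such that
every map from `G` to a group that respects them agrees on `S` with a homomorphism.  This is a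
form of finite presentability. -/
def FinitelyTestedHoms (G : Type) [Group G] : Prop :=
  ∃ S : Set G, S.Finite ∧ Subgroup.closure S = ⊤ ∧ ∃ P : Set (G × G), P.Finite ∧
    ∀ (E : Type) [Group E] (φ : G → E), (∀ p ∈ P, φ (p.1 * p.2) = φ p.1 * φ p.2) →
      ∃ ψ : G →* E, ∀ s ∈ S, ψ s = φ s

/-- On an element of the subgroup generated by `S`, a map that respects finitely many products
agrees with any homomorphism with which it agrees on `S`. -/
theorem exists_finite_test_of_mem_closure {G : Type} [Group G] {S : Set G} {g : G}
    (hg : g ∈ Subgroup.closure S) :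
    ∃ P : Set (G × G), P.Finite ∧ ∀ (E : Type) [Group E] (φ : G → E) (ψ : G →* E),
      (∀ p ∈ P, φ (p.1 * p.2) = φ p.1 * φ p.2) → (∀ s ∈ S, ψ s = φ s) → ψ g = φ g := by
  induction hg using Subgroup.closure_induction with
  | mem x hx => exact ⟨∅, Set.finite_empty, fun E _ φ ψ _ h => h x hx⟩
  | one =>
    refine ⟨{(1, 1)}, Set.finite_singleton _, fun E _ φ ψ h _ => ?_⟩
    have := h (1, 1) rfl
    simpa [eq_comm] using this
  | mul x y _ _ hx hy =>
    obtain ⟨P, hP, hP'⟩ := hx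
    obtain ⟨Q, hQ, hQ'⟩ := hy
    refine ⟨insert (x, y) (P ∪ Q), (hP.union hQ).insert _, fun E _ φ ψ h hS => ?_⟩
    rw [map_mul, hP' E φ ψ (fun p hp => h p (by simp [hp])) hS,
      hQ' E φ ψ (fun p hp => h p (by simp [hp])) hS]
    exact (h (x, y) (by simp)).symm
  | inv x _ hx =>
    obtain ⟨P, hP, hP'⟩ := hx
    refine ⟨insert (1, 1) (insert (x, x⁻¹) P), (hP.insert _).insert _, fun E _ φ ψ h hS => ?_⟩
    have h1 := h (1, 1) (by simp)
    have h2 := h (x, x⁻¹) (by simp)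
    rw [map_inv, hP' E φ ψ (fun p hp => h p (by simp [hp])) hS]
    simp only [mul_one, left_eq_mul] at h1
    simp only [mul_inv_cancel, h1] at h2
    exact (eq_inv_of_mul_eq_one_right h2.symm).symm

namespace FinitelyTestedHoms

/-- Each element of `T` is a word in `S`, so agreement on `S` extends to `T` at the cost of finitely
many more tests. -/
theorem exists_test {G : Type} [Group G] (hG : FinitelyTestedHoms G) {T : Set G}
    (hT : T.Finite) :
    ∃ P : Set (G × G), P.Finite ∧
      ∀ (E : Type) [Group E] (φ : G → E), (∀ p ∈ P, φ (p.1 * p.2) = φ p.1 * φ p.2) →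
        ∃ ψ : G →* E, ∀ t ∈ T, ψ t = φ t := by
  obtain ⟨S, -, hS, P, hP, h⟩ := hG
  choose Q hQ hQ' using fun g : G =>
    exists_finite_test_of_mem_closure (S := S) (g := g) (hS ▸ Subgroup.mem_top g)
  refine ⟨P ∪ ⋃ t ∈ T, Q t, hP.union (hT.biUnion fun t _ => hQ t), fun E _ φ hφ => ?_⟩
  obtain ⟨ψ, hψ⟩ := h E φ fun p hp => hφ p (Or.inl hp)
  exact ⟨ψ, fun t ht => hQ' t E φ ψ
    (fun p hp => hφ p (Or.inr (Set.mem_biUnion ht hp))) hψ⟩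

theorem freeGroup (ι : Type) [Finite ι] : FinitelyTestedHoms (FreeGroup ι) :=
  ⟨Set.range FreeGroup.of, Set.finite_range _, FreeGroup.closure_range_of ι, ∅, Set.finite_empty,
    fun E _ φ _ => ⟨FreeGroup.lift (φ ∘ FreeGroup.of), by rintro _ ⟨i, rfl⟩; simp⟩⟩

theorem pi {ι : Type} [Finite ι] {N : Type} [Group N] (hN : FinitelyTestedHoms N) :
    FinitelyTestedHoms (ι → N) := by
  classical
  have := Fintype.ofFinite ι
  obtain ⟨S, hS, hS', P, hP, h⟩ := hN
  have hclosure (i : ι) : (⊤ : Subgroup N).map (MonoidHom.mulSingle (fun _ : ι => N) i) =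
      Subgroup.closure (Pi.mulSingle i '' S) := by
    rw [← hS', MonoidHom.map_closure]; rfl
  -- `P` in each factor yields homomorphisms `ψ i`; pairs of generators from different factors make
  -- their images commute.
  let C : Set ((ι → N) × (ι → N)) :=
    ⋃ x : ι × ι, (fun y : N × N => (Pi.mulSingle x.1 y.1, Pi.mulSingle x.2 y.2)) ''
      (P ∪ S ×ˢ S)
  refine ⟨⋃ i, Pi.mulSingle i '' S, Set.finite_iUnion fun i => hS.image _, ?_, C,
    Set.finite_iUnion fun i => (hP.union (hS.prod hS)).image _, fun E _ φ hφ => ?_⟩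
  · rw [eq_top_iff, ← Subgroup.pi_top (Set.univ : Set ι), Subgroup.pi_le_iff]
    intro i
    rw [hclosure, Subgroup.closure_le]
    exact (Set.subset_iUnion (fun i => Pi.mulSingle i '' S) i).trans Subgroup.subset_closure
  · have hC (i j : ι) (y : N × N) (hy : y ∈ P ∪ S ×ˢ S) :
        φ (Pi.mulSingle i y.1 * Pi.mulSingle j y.2) =
          φ (Pi.mulSingle i y.1) * φ (Pi.mulSingle j y.2) :=
      hφ (Pi.mulSingle i y.1, Pi.mulSingle j y.2) (Set.mem_iUnion.2 ⟨(i, j), y, hy, rfl⟩)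
    choose ψ hψ using fun i => h E (fun n => φ (Pi.mulSingle i n)) fun p hp => by
      rw [Pi.mulSingle_mul]
      exact hC i i p (Or.inl hp)
    have hcomm : Pairwise fun i j => ∀ x y, Commute (ψ i x) (ψ j y) := by
      intro i j hij
      have hSS (x) (hx : x ∈ S) (y) (hy : y ∈ S) : Commute (ψ i x) (ψ j y) := by
        rw [hψ i x hx, hψ j y hy]
        have h1 : φ (Pi.mulSingle i x * Pi.mulSingle j y) = _ := hC i j (x, y) (Or.inr ⟨hx, hy⟩)
        have h2 := hC j i (y, x) (Or.inr ⟨hy, hx⟩)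
        rw [(Pi.mulSingle_commute (f := fun _ : ι => N) hij x y).eq] at h1
        exact h1.symm.trans h2
      have hSN (x) (hx : x ∈ S) (y : N) : Commute (ψ i x) (ψ j y) := by
        have hy : y ∈ Subgroup.closure S := hS' ▸ Subgroup.mem_top y
        induction hy using Subgroup.closure_induction with
        | mem y hy => exact hSS x hx y hy
        | one => simp
        | mul y z _ _ hy hz => rw [map_mul]; exact hy.mul_right hz
        | inv y _ hy => rw [map_inv]; exact hy.inv_right
      intro x y
      have hx : x ∈ Subgroup.closure S := hS' ▸ Subgroup.mem_top x
      induction hx using Subgroup.closure_induction with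
      | mem x hx => exact hSN x hx y
      | one => simp
      | mul x z _ _ hx hz => rw [map_mul]; exact hx.mul_left hz
      | inv x _ hx => rw [map_inv]; exact hx.inv_left
    refine ⟨MonoidHom.noncommPiCoprod ψ hcomm, fun s hs => ?_⟩
    obtain ⟨i, x, hx, rfl⟩ := Set.mem_iUnion.1 hs
    rw [MonoidHom.noncommPiCoprod_mulSingle, hψ i x hx]

end FinitelyTestedHoms

/-- A map that carries left multiplication by generators to left multiplication, and `1` to `1`,
is a homomorphism. -/
theorem exists_monoidHom_of_map_mul_left {G E : Type*} [Group G] [Group E] {S : Set G}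
    (hS : Subgroup.closure S = ⊤) (ψ : G → E) (h1 : ψ 1 = 1)
    (h : ∀ x ∈ S, ∀ g, ψ (x * g) = ψ x * ψ g) : ∃ f : G →* E, ⇑f = ψ := by
  refine ⟨⟨⟨ψ, h1⟩, fun x g => ?_⟩, rfl⟩
  have hx : x ∈ Subgroup.closure S := hS ▸ Subgroup.mem_top x
  change ψ (x * g) = ψ x * ψ g
  induction hx using Subgroup.closure_induction generalizing g with
  | mem x hx => exact h x hx g
  | one => simp [h1]
  | mul x y _ _ hx hy => rw [mul_assoc, hx, hy, hx y, mul_assoc]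
  | inv x _ hx =>
    have key (g : G) : ψ (x⁻¹ * g) = (ψ x)⁻¹ * ψ g := by
      rw [eq_inv_mul_iff_mul_eq, ← hx, mul_inv_cancel_left]
    have := key 1
    rw [mul_one, h1, mul_one] at this
    rw [key, this]

theorem FinitelyTestedHoms.of_finiteIndex {N G : Type} [Group N] [Group G]
    (hN : FinitelyTestedHoms N) (j : N →* G) (hj : Function.Injective j)
    (hfin : j.range.FiniteIndex) : FinitelyTestedHoms G := by
  let t : G ⧸ j.range → G := Quotient.out
  have ht (g : G) : ∃ n : N, t g * j n = g := by
    obtain ⟨n, hn⟩ := (QuotientGroup.eq (s := j.range)).1 (QuotientGroup.out_eq' (g : G ⧸ j.range))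
    exact ⟨n, by rw [hn]; simp [t]⟩
  choose m hm using ht
  have hNt := hN
  obtain ⟨S, hS, hS', -⟩ := hNt
  let S' : Set G := Set.range t ∪ j '' S
  have hS'fin : S'.Finite := (Set.finite_range t).union (hS.image _)
  have hgen : Subgroup.closure S' = ⊤ := by
    rw [eq_top_iff]
    intro g _
    rw [← hm g]
    refine mul_mem (Subgroup.subset_closure (Or.inl ⟨_, rfl⟩)) ?_
    have : j (m g) ∈ (Subgroup.closure S).map j := ⟨m g, by simp [hS'], rfl⟩
    rw [MonoidHom.map_closure] at this
    exact Subgroup.closure_mono Set.subset_union_right this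
  -- Writing `g = t g * j (m g)`, these are the `N`-parts of `1` and of generator times coset
  -- representative, the only places where `σ` must agree with `φ ∘ j`.
  let M : Set N := insert (m 1) ((fun x : G × G => m (x.1 * x.2)) '' (S' ×ˢ Set.range t))
  have hM : M.Finite := ((hS'fin.prod (Set.finite_range t)).image _).insert _
  obtain ⟨P, hP, hP'⟩ := hN.exists_test hM
  refine ⟨S', hS'fin, hgen, {(1, 1)} ∪ Prod.map j j '' P ∪ S' ×ˢ Set.range t ∪
    Set.range t ×ˢ (j '' M), ?_, fun E _ φ hφ => ?_⟩
  · exact (((Set.finite_singleton _).union (hP.image _)).union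
      (hS'fin.prod (Set.finite_range t))).union ((Set.finite_range t).prod (hM.image _))
  obtain ⟨σ, hσ⟩ := hP' E (φ ∘ j) fun p hp => by
    have := hφ (Prod.map j j p) (Or.inl (Or.inl (Or.inr ⟨p, hp, rfl⟩)))
    simpa using this
  have h1 : φ 1 = 1 := by
    have := hφ (1, 1) (Or.inl (Or.inl (Or.inl rfl)))
    simpa using this
  have htM (q) (n) (hn : n ∈ M) : φ (t q * j n) = φ (t q) * σ n := by
    rw [hσ n hn]
    exact hφ (t q, j n) (Or.inr ⟨⟨q, rfl⟩, n, hn, rfl⟩)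
  have hψ1 : φ (t (1 : G)) * σ (m 1) = 1 := by
    rw [← htM _ _ (Set.mem_insert _ _), hm, h1]
  have hψS (x) (hx : x ∈ S') (g : G) :
      φ (t (x * g : G)) * σ (m (x * g)) = φ x * (φ (t g) * σ (m g)) := by
    have hq : ((x * g : G) : G ⧸ j.range) = (x * t g : G) := by
      rw [QuotientGroup.eq]
      refine ⟨(m g)⁻¹, ?_⟩
      nth_rw 2 [← hm g]
      simp [mul_assoc]
    have hmul : m (x * g) = m (x * t g) * m g := by
      apply hj
      rw [map_mul]
      apply mul_left_cancel (a := t (x * g : G))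
      rw [hm, ← mul_assoc, hq, hm, mul_assoc, hm]
    rw [hmul, map_mul, hq, ← mul_assoc, ← htM _ _ (Set.mem_insert_of_mem _
      ⟨(x, t g), ⟨hx, _, rfl⟩, rfl⟩), hm, ← mul_assoc]
    congr 1
    exact hφ (x, t g) (Or.inl (Or.inr ⟨hx, _, rfl⟩))
  have hψx (x) (hx : x ∈ S') : φ (t x) * σ (m x) = φ x := by
    have := hψS x hx 1
    rwa [hψ1, mul_one, mul_one] at this
  -- The extension of `σ` is forced on representatives: `t g * j (m g)` goes to `φ (t g) * σ (m g)`.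
  obtain ⟨f, hf⟩ := exists_monoidHom_of_map_mul_left hgen (fun g : G => φ (t g) * σ (m g)) hψ1
    fun x hx g => by rw [hψS x hx g, hψx x hx]
  exact ⟨f, fun x hx => by rw [hf]; exact hψx x hx⟩

/-! ### Central extensions and second cohomology -/

/-- The central extension of `G` by `ℤ` with underlying set `ℤ × G` defined by a function
`c : G × G → ℤ`; it is a group when `c` is a `2`-cocycle. -/
@[ext]
structure TwistedProduct {G : Type} (c : G × G → ℤ) where
  coeff : ℤ
  base : G

namespace TwistedProduct

variable {G : Type} [Group G] {c : G × G → ℤ}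

/-- The group structure defined by a `2`-cocycle. -/
abbrev group (hc : ∀ g h j : G, c (g * h, j) + c (g, h) = c (h, j) + c (g, h * j)) :
    Group (TwistedProduct c) :=
  letI : Mul (TwistedProduct c) :=
    ⟨fun x y => ⟨x.coeff + y.coeff + c (x.base, y.base), x.base * y.base⟩⟩
  letI : One (TwistedProduct c) := ⟨⟨-c (1, 1), 1⟩⟩
  letI : Inv (TwistedProduct c) :=
    ⟨fun x => ⟨-x.coeff - c (x.base⁻¹, x.base) - c (1, 1), x.base⁻¹⟩⟩
  Group.ofLeftAxioms
    (fun x y z => by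
      have := hc x.base y.base z.base
      ext
      · change x.coeff + y.coeff + c (x.base, y.base) + z.coeff + c (x.base * y.base, z.base) =
          x.coeff + (y.coeff + z.coeff + c (y.base, z.base)) + c (x.base, y.base * z.base)
        linarith
      · exact mul_assoc _ _ _)
    (fun x => by
      have := hc 1 1 x.base
      rw [one_mul, one_mul] at this
      ext
      · change -c (1, 1) + x.coeff + c (1, x.base) = x.coeff
        linarith
      · exact one_mul _)
    (fun x => by
      ext
      · change -x.coeff - c (x.base⁻¹, x.base) - c (1, 1) + x.coeff + c (x.base⁻¹, x.base) =
          -c (1, 1)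
        ring
      · exact inv_mul_cancel _)

end TwistedProduct

open groupCohomology in
theorem FinitelyTestedHoms.fg_H2 {G : Type} [Group G] (hG : FinitelyTestedHoms G) :
    AddGroup.FG (groupCohomology (Rep.trivial ℤ G ℤ) 2) := by
  obtain ⟨S, -, hS, P, hP, h⟩ := hG
  let ev : cocycles₂ (Rep.trivial ℤ G ℤ) →ₗ[ℤ] (P → ℤ) :=
    { toFun := fun c p => c p.1
      map_add' := fun _ _ => rfl
      map_smul' := fun _ _ => rfl }
  have hker : LinearMap.ker ev ≤ LinearMap.ker (H2π (Rep.trivial ℤ G ℤ)).hom := by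
    intro c hc
    have hc0 (p) (hp : p ∈ P) : c p = (0 : ℤ) := congrFun (LinearMap.mem_ker.1 hc) ⟨p, hp⟩
    refine (H2π_eq_zero_iff c).2 ?_
    let f : G × G → ℤ := fun p => c p
    let _ : Group (TwistedProduct f) := TwistedProduct.group fun g h j =>
      (mem_cocycles₂_iff (A := Rep.trivial ℤ G ℤ) f).1 c.2 g h j
    let π : TwistedProduct f →* G := MonoidHom.mk' TwistedProduct.base fun _ _ => rfl
    obtain ⟨ψ, hψ⟩ := h (TwistedProduct f) (fun g => ⟨0, g⟩) fun p hp => by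
      change (⟨0, p.1 * p.2⟩ : TwistedProduct f) = ⟨0 + 0 + f p, p.1 * p.2⟩
      rw [show f p = 0 from hc0 p hp]
      simp
    have hπ : π.comp ψ = MonoidHom.id G :=
      MonoidHom.eq_of_eqOn_dense hS fun s hs => congrArg TwistedProduct.base (hψ s hs)
    have hbase (g : G) : (ψ g).base = g := DFunLike.congr_fun hπ g
    -- Multiplicativity of the splitting `g ↦ (b g, g)` says that the cocycle is the coboundary of
    -- `-b`.
    refine ⟨fun g => -(ψ g).coeff, funext fun p => ?_⟩
    have hmul : (ψ (p.1 * p.2)).coeff =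
        (ψ p.1).coeff + (ψ p.2).coeff + f ((ψ p.1).base, (ψ p.2).base) :=
      congrArg TwistedProduct.coeff (map_mul ψ p.1 p.2)
    rw [hbase, hbase] at hmul
    change -(ψ p.2).coeff - -(ψ (p.1 * p.2)).coeff + -(ψ p.1).coeff = f p
    rw [hmul]
    change _ = f (p.1, p.2)
    ring
  have : Finite P := hP
  have hfin : Module.Finite ℤ (cocycles₂ (Rep.trivial ℤ G ℤ) ⧸ LinearMap.ker ev) :=
    Module.Finite.equiv ev.quotKerEquivRange.symm
  have hsurj : Function.Surjective (H2π (Rep.trivial ℤ G ℤ)).hom :=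
    (ModuleCat.epi_iff_surjective _).1 inferInstance
  have : Module.Finite ℤ (groupCohomology (Rep.trivial ℤ G ℤ) 2) :=
    Module.Finite.of_surjective ((LinearMap.ker ev).liftQ _ hker)
      (LinearMap.range_eq_top.1 (by rw [Submodule.range_liftQ, LinearMap.range_eq_top.2 hsurj]))
  refine Module.Finite.iff_addGroup_fg.1 ?_
  convert! this
  exact Subsingleton.elim _ _

/-! ### The Sanov subgroup of $SL(2,\mathbb{Z})$ -/

open Matrix

theorem specialLinearGroup_mul_apply (γ δ : SpecialLinearGroup (Fin 2) ℤ) (i j : Fin 2) :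
    (γ * δ) i j = γ i 0 * δ 0 j + γ i 1 * δ 1 j := by
  change (γ.1 * δ.1) i j = _
  rw [Matrix.mul_apply, Fin.sum_univ_two]

/-- The generators of the Sanov subgroup of `SL(2, ℤ)`. -/
def sanovGenerator (i : Fin 2) : SpecialLinearGroup (Fin 2) ℤ :=
  if i = 0 then ⟨!![1, 2; 0, 1], by simp⟩ else ⟨!![1, 0; 2, 1], by simp⟩

/-- The homomorphism from the free group of rank two onto the Sanov subgroup of `SL(2, ℤ)`. -/
def sanovHom : FreeGroup (Fin 2) →* SpecialLinearGroup (Fin 2) ℤ :=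
  FreeGroup.lift sanovGenerator

theorem sanovGenerator_zero_mul (g : SpecialLinearGroup (Fin 2) ℤ) (j : Fin 2) :
    (sanovGenerator 0 * g) 0 j = g 0 j + 2 * g 1 j ∧ (sanovGenerator 0 * g) 1 j = g 1 j := by
  rw [specialLinearGroup_mul_apply, specialLinearGroup_mul_apply]
  simp [sanovGenerator]

theorem sanovGenerator_one_mul (g : SpecialLinearGroup (Fin 2) ℤ) (j : Fin 2) :
    (sanovGenerator 1 * g) 0 j = g 0 j ∧ (sanovGenerator 1 * g) 1 j = 2 * g 0 j + g 1 j := by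
  rw [specialLinearGroup_mul_apply, specialLinearGroup_mul_apply]
  simp [sanovGenerator]

theorem sanovGenerator_zero_inv_mul (g : SpecialLinearGroup (Fin 2) ℤ) (j : Fin 2) :
    ((sanovGenerator 0)⁻¹ * g) 0 j = g 0 j - 2 * g 1 j ∧
      ((sanovGenerator 0)⁻¹ * g) 1 j = g 1 j := by
  obtain ⟨h0, h1⟩ := sanovGenerator_zero_mul ((sanovGenerator 0)⁻¹ * g) j
  rw [mul_inv_cancel_left] at h0 h1
  omega

theorem sanovGenerator_one_inv_mul (g : SpecialLinearGroup (Fin 2) ℤ) (j : Fin 2) :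
    ((sanovGenerator 1)⁻¹ * g) 0 j = g 0 j ∧
      ((sanovGenerator 1)⁻¹ * g) 1 j = g 1 j - 2 * g 0 j := by
  obtain ⟨h0, h1⟩ := sanovGenerator_one_mul ((sanovGenerator 1)⁻¹ * g) j
  rw [mul_inv_cancel_left] at h0 h1
  omega

/-- The first column of `g` has slope at least `1`, respectively in `[0, 1)`. -/
def sanovAttracting : Fin 2 → Set (SpecialLinearGroup (Fin 2) ℤ)
  | 0 => {g | 0 < g 1 0 ∧ g 1 0 ≤ g 0 0 ∨ g 1 0 < 0 ∧ g 0 0 ≤ g 1 0 ∨ g 1 0 = 0}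
  | 1 => {g | 0 ≤ g 0 0 ∧ g 0 0 < g 1 0 ∨ g 1 0 < g 0 0 ∧ g 0 0 ≤ 0}

/-- The first column of `g` has slope less than `-1`, respectively in `[-1, 0)`. -/
def sanovRepelling : Fin 2 → Set (SpecialLinearGroup (Fin 2) ℤ)
  | 0 => {g | 0 < g 1 0 ∧ g 0 0 < -g 1 0 ∨ g 1 0 < 0 ∧ -g 1 0 < g 0 0}
  | 1 => {g | -g 1 0 ≤ g 0 0 ∧ g 0 0 < 0 ∨ 0 < g 0 0 ∧ g 0 0 ≤ -g 1 0}

theorem first_column_ne_zero (g : SpecialLinearGroup (Fin 2) ℤ) : g 0 0 ≠ 0 ∨ g 1 0 ≠ 0 := by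
  by_contra! h
  have hdet : g 0 0 * g 1 1 - g 0 1 * g 1 0 = 1 := by
    rw [← Matrix.det_fin_two]; exact g.2
  simp [h.1, h.2] at hdet

-- Ping-pong on the slope of the first column, which the generators move by $x\mapsto x+2$ and
-- $1/x\mapsto 1/x+2$.
open Pointwise in
theorem sanovHom_injective : Function.Injective sanovHom := by
  refine FreeGroup.injective_lift_of_ping_pong sanovGenerator sanovAttracting sanovRepelling
    ?_ ?_ ?_ ?_ ?_ ?_
  · intro i
    fin_cases i
    · exact ⟨1, by simp [sanovAttracting]⟩
    · exact ⟨ModularGroup.S, Or.inl (by decide)⟩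
  · intro i j hij
    rw [Function.onFun, Set.disjoint_left]
    intro g hi hj
    fin_cases i <;> fin_cases j <;> simp [sanovAttracting] at hij hi hj <;> omega
  · intro i j hij
    rw [Function.onFun, Set.disjoint_left]
    intro g hi hj
    fin_cases i <;> fin_cases j <;> simp [sanovRepelling] at hij hi hj <;> omega
  · intro i j
    rw [Set.disjoint_left]
    intro g hi hj
    fin_cases i <;> fin_cases j <;> simp [sanovAttracting, sanovRepelling] at hi hj <;> omega
  · rintro i _ ⟨g, hg, rfl⟩
    fin_cases i
    · obtain ⟨h0, h1⟩ := sanovGenerator_zero_mul g 0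
      change g ∉ sanovRepelling 0 at hg
      change sanovGenerator 0 * g ∈ sanovAttracting 0
      simp only [sanovAttracting, sanovRepelling, Set.mem_ofPred_eq, h0, h1] at hg ⊢
      omega
    · obtain ⟨h0, h1⟩ := sanovGenerator_one_mul g 0
      have hne := first_column_ne_zero g
      change g ∉ sanovRepelling 1 at hg
      change sanovGenerator 1 * g ∈ sanovAttracting 1
      simp only [sanovAttracting, sanovRepelling, Set.mem_ofPred_eq, h0, h1] at hg ⊢
      omega
  · rintro i _ ⟨g, hg, rfl⟩
    fin_cases i
    · obtain ⟨h0, h1⟩ := sanovGenerator_zero_inv_mul g 0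
      change g ∉ sanovAttracting 0 at hg
      change (sanovGenerator 0)⁻¹ * g ∈ sanovRepelling 0
      simp only [sanovAttracting, sanovRepelling, Set.mem_ofPred_eq, h0, h1] at hg ⊢
      omega
    · obtain ⟨h0, h1⟩ := sanovGenerator_one_inv_mul g 0
      have hne := first_column_ne_zero g
      change g ∉ sanovAttracting 1 at hg
      change (sanovGenerator 1)⁻¹ * g ∈ sanovRepelling 1
      simp only [sanovAttracting, sanovRepelling, Set.mem_ofPred_eq, h0, h1] at hg ⊢
      omega

/-- The Sanov subgroup contains every matrix `(a b; c d)` with `a ≡ 1 (mod 4)` and `b`, `c`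
even. -/
theorem mem_range_sanovHom (g : SpecialLinearGroup (Fin 2) ℤ) (ha : g 0 0 % 4 = 1)
    (hb : g 0 1 % 2 = 0) (hc : g 1 0 % 2 = 0) : g ∈ sanovHom.range := by
  have hmem (i : Fin 2) : sanovGenerator i ∈ sanovHom.range :=
    ⟨FreeGroup.of i, FreeGroup.lift_apply_of⟩
  induction hn : (g 0 0).natAbs + (g 1 0).natAbs using Nat.strong_induction_on generalizing g with
  | _ n ih =>
  have hdet : g 0 0 * g 1 1 - g 0 1 * g 1 0 = 1 := by
    rw [← Matrix.det_fin_two]; exact g.2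
  have hd : g 1 1 % 2 = 1 := by
    obtain ⟨k, hk⟩ := Int.dvd_of_emod_eq_zero hb
    obtain h | h := Int.emod_two_eq_zero_or_one (g 1 1)
    · obtain ⟨l, hl⟩ := Int.dvd_of_emod_eq_zero h
      rw [hk, hl] at hdet
      have : 2 * (g 0 0 * l - k * g 1 0) = 1 := by linarith
      omega
    · exact h
  have step (x : SpecialLinearGroup (Fin 2) ℤ) (hx : x ∈ sanovHom.range)
      (h0 : (x * g) 0 0 % 4 = 1) (h1 : (x * g) 0 1 % 2 = 0) (h2 : (x * g) 1 0 % 2 = 0)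
      (hlt : ((x * g) 0 0).natAbs + ((x * g) 1 0).natAbs < n) : g ∈ sanovHom.range :=
    (Subgroup.mul_mem_cancel_left _ hx).1 (ih _ hlt (x * g) h0 h1 h2 rfl)
  have e0 := sanovGenerator_zero_mul g
  have e1 := sanovGenerator_one_mul g
  have e0' := sanovGenerator_zero_inv_mul g
  have e1' := sanovGenerator_one_inv_mul g
  by_cases hc0 : g 1 0 = 0
  · rw [hc0, mul_zero, sub_zero] at hdet
    obtain ⟨h1, h2⟩ | ⟨h1, -⟩ := Int.mul_eq_one_iff_eq_one_or_neg_one.1 hdet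
    · have hT : sanovGenerator 0 = ModularGroup.T ^ (2 : ℤ) := by
        ext i j
        rw [ModularGroup.coe_T_zpow]
        rfl
      have hg : g = sanovGenerator 0 ^ (g 0 1 / 2) := by
        rw [hT, ← _root_.zpow_mul, Int.mul_ediv_cancel' (Int.dvd_of_emod_eq_zero hb)]
        ext i j
        rw [ModularGroup.coe_T_zpow]
        fin_cases i <;> fin_cases j <;> simp [h1, h2, hc0]
      rw [hg]
      exact zpow_mem (hmem 0) _
    · omega
  -- Euclidean descent on the first column $(a,c)$: since $a$ is odd and $c$ even, $|a|\ne|c|$, and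
  -- adding or subtracting twice the smaller entry shrinks the larger one.
  have hodd : g 1 0 < 0 ∧ g 0 0 < 0 ∨ 0 < g 1 0 ∧ 0 < g 0 0 ∨
    g 1 0 < 0 ∧ 0 < g 0 0 ∨ 0 < g 1 0 ∧ g 0 0 < 0 := by omega
  by_cases hlt : (g 1 0).natAbs < (g 0 0).natAbs
  · by_cases hs : 0 < g 1 0 ↔ 0 < g 0 0
    · refine step _ (inv_mem (hmem 0)) ?_ ?_ ?_ ?_ <;> simp only [e0'] <;> omega
    · refine step _ (hmem 0) ?_ ?_ ?_ ?_ <;> simp only [e0] <;> omega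
  · by_cases hs : 0 < g 1 0 ↔ 0 < g 0 0
    · refine step _ (inv_mem (hmem 1)) ?_ ?_ ?_ ?_ <;> simp only [e1'] <;> omega
    · refine step _ (hmem 1) ?_ ?_ ?_ ?_ <;> simp only [e1] <;> omega

theorem finiteIndex_range_sanovHom : sanovHom.range.FiniteIndex := by
  refine Subgroup.finiteIndex_of_le (H := CongruenceSubgroup.Gamma 4) fun g hg => ?_
  rw [CongruenceSubgroup.Gamma_mem] at hg
  obtain ⟨h00, h01, h10, -⟩ := hg
  have h00' : ((g 0 0 - 1 : ℤ) : ZMod 4) = 0 := by push_cast; rw [h00, sub_self]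
  rw [ZMod.intCast_zmod_eq_zero_iff_dvd] at h00'
  rw [ZMod.intCast_zmod_eq_zero_iff_dvd] at h01 h10
  exact mem_range_sanovHom g (by omega) (by omega) (by omega)

/-- Elements of the Sanov subgroup have the form `(a b; c d)` with `a` and `d` congruent to `1`
modulo `4` and `b`, `c` even. -/
theorem sanovHom_apply_mod (w : FreeGroup (Fin 2)) :
    sanovHom w 0 0 % 4 = 1 ∧ sanovHom w 0 1 % 2 = 0 ∧ sanovHom w 1 0 % 2 = 0 ∧
      sanovHom w 1 1 % 4 = 1 := by
  have hof (i : Fin 2) : sanovHom (FreeGroup.of i) = sanovGenerator i := FreeGroup.lift_apply_of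
  have step (x : SpecialLinearGroup (Fin 2) ℤ) (i : Fin 2) (hx : x 0 0 % 4 = 1 ∧
      x 0 1 % 2 = 0 ∧ x 1 0 % 2 = 0 ∧ x 1 1 % 4 = 1) : ((sanovGenerator i * x) 0 0 % 4 = 1 ∧
      (sanovGenerator i * x) 0 1 % 2 = 0 ∧ (sanovGenerator i * x) 1 0 % 2 = 0 ∧
      (sanovGenerator i * x) 1 1 % 4 = 1) ∧ (((sanovGenerator i)⁻¹ * x) 0 0 % 4 = 1 ∧
      ((sanovGenerator i)⁻¹ * x) 0 1 % 2 = 0 ∧ ((sanovGenerator i)⁻¹ * x) 1 0 % 2 = 0 ∧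
      ((sanovGenerator i)⁻¹ * x) 1 1 % 4 = 1) := by
    have e0 := sanovGenerator_zero_mul x
    have e1 := sanovGenerator_one_mul x
    have e0' := sanovGenerator_zero_inv_mul x
    have e1' := sanovGenerator_one_inv_mul x
    obtain rfl | rfl : i = 0 ∨ i = 1 := by omega
    · simp only [e0, e0']; omega
    · simp only [e1, e1']; omega
  have hw : w ∈ Subgroup.closure (Set.range FreeGroup.of) :=
    FreeGroup.closure_range_of (Fin 2) ▸ Subgroup.mem_top w
  induction hw using Subgroup.closure_induction_left with
  | one => simp
  | mul_left x hx y _ ih =>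
    obtain ⟨i, rfl⟩ := hx
    rw [map_mul, hof]
    exact (step _ i ih).1
  | inv_mul_cancel x hx y _ ih =>
    obtain ⟨i, rfl⟩ := hx
    rw [map_mul, map_inv, hof]
    exact (step _ i ih).2

/-! ### The normalizer and its quotient -/

namespace ToroidalOrbifold

theorem signMatrix_commute (s : ℤˣ) (γ : SpecialLinearGroup (Fin 2) ℤ) :
    Commute (signMatrix s) γ := by
  rw [signMatrix]
  split_ifs
  · exact Commute.one_left γ
  · exact Commute.neg_one_left γ

theorem torusAct_neg_one (ε : Torus) : torusAct (-1) ε = -ε := by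
  ext <;> simp [torusAct]

theorem torusAct_zero (γ : SpecialLinearGroup (Fin 2) ℤ) : torusAct γ 0 = 0 := by
  simp [torusAct]

theorem two_nsmul_torusAct {γ : SpecialLinearGroup (Fin 2) ℤ} {ε : Torus}
    (hε : (2 : ℕ) • ε = 0) : (2 : ℕ) • torusAct γ ε = 0 := by
  rw [two_nsmul] at hε ⊢
  rw [← torusAct_add, hε, torusAct_zero]

/-- Matrices congruent to the identity modulo `2` fix the `2`-torsion points. -/
theorem torusAct_eq_self {γ : SpecialLinearGroup (Fin 2) ℤ} (h00 : γ 0 0 % 2 = 1)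
    (h01 : γ 0 1 % 2 = 0) (h10 : γ 1 0 % 2 = 0) (h11 : γ 1 1 % 2 = 1) {ε : Torus}
    (hε : (2 : ℕ) • ε = 0) : torusAct γ ε = ε := by
  have key (x : UnitAddCircle) (hx : (2 : ℕ) • x = 0) (n : ℤ) : n • x = (n % 2) • x := by
    conv_lhs => rw [← Int.emod_add_mul_ediv n 2]
    rw [add_smul, mul_comm, mul_smul, ofNat_zsmul, hx, smul_zero, add_zero]
  have h1 : (2 : ℕ) • ε.1 = 0 := congrArg Prod.fst hε
  have h2 : (2 : ℕ) • ε.2 = 0 := congrArg Prod.snd hε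
  ext
  · simp only [torusAct]
    rw [key _ h1, key _ h2, h00, h01]
    simp
  · simp only [torusAct]
    rw [key _ h1, key _ h2, h10, h11]
    simp

theorem sanovHom_inr_commute (w : FreeGroup (Fin 2)) {a : A} {s : ℤˣ}
    (hs : a.right = signMatrix s) (ha : (2 : ℕ) • a.left.toAdd = 0) :
    Commute (SemidirectProduct.inr (sanovHom w) : A) a := by
  obtain ⟨h00, h01, h10, h11⟩ := sanovHom_apply_mod w
  ext1
  · rw [SemidirectProduct.mul_left, SemidirectProduct.mul_left, SemidirectProduct.left_inr,
      SemidirectProduct.right_inr, one_mul, map_one, mul_one]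
    exact congrArg Multiplicative.ofAdd
      (torusAct_eq_self (by omega) (by omega) (by omega) (by omega) ha)
  · rw [SemidirectProduct.mul_right, SemidirectProduct.mul_right, SemidirectProduct.right_inr, hs]
    exact (signMatrix_commute _ _).symm

/-- The product of three Sanov subgroups in `A⁽³⁾`. -/
def sanovA3 : (Fin 3 → FreeGroup (Fin 2)) →* A3 :=
  SemidirectProduct.inl.comp (MonoidHom.pi fun i =>
    (SemidirectProduct.inr.comp sanovHom).comp (Pi.evalMonoidHom _ i))

theorem sanovA3_apply (w : Fin 3 → FreeGroup (Fin 2)) :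
    sanovA3 w = SemidirectProduct.inl fun i => SemidirectProduct.inr (sanovHom (w i)) := rfl

theorem HasTwist.commute_sanovA3 {g : A3} {s : Fin 3 → ℤˣ} (hg : HasTwist g s)
    (w : Fin 3 → FreeGroup (Fin 2)) : Commute (sanovA3 w) g := by
  have hg' : g = SemidirectProduct.inl g.left := by
    ext1
    · rfl
    · exact hg.perm
  rw [hg', sanovA3_apply]
  refine Commute.map (f := SemidirectProduct.inl) (funext fun i => ?_)
  exact sanovHom_inr_commute (w i) (hg.twist i) (hg.shift i)

theorem sanovA3_mem_normalizer {G : Subgroup A3} (hG : IsOrbifoldGroup G)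
    (w : Fin 3 → FreeGroup (Fin 2)) : sanovA3 w ∈ H G := by
  have h (w) (g) (hg : g ∈ G) : sanovA3 w * g * (sanovA3 w)⁻¹ ∈ G := by
    obtain ⟨s, -, hs⟩ := hG.le_max g hg
    rwa [(hs.commute_sanovA3 w).eq, mul_inv_cancel_right]
  rw [Subgroup.mem_normalizer_iff]
  refine fun g => ⟨h w g, fun hg => ?_⟩
  have := h w⁻¹ _ hg
  rw [map_inv] at this
  simpa [mul_assoc] using this

/-- Conjugating an element with $-I$ in one factor by a translation $t$ shifts it by $2t$. The
result must again have 2-torsion shift, so $4t=0$. -/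
theorem four_nsmul_eq_zero_of_mem_normalizer {G : Subgroup A3} (hG : IsOrbifoldGroup G) {h : A3}
    (hh : h ∈ H G) (i : Fin 3) : (4 : ℕ) • (h.left i).left.toAdd = 0 := by
  obtain ⟨s, hs, hsi⟩ : ∃ s : Fin 3 → ℤˣ, ∏ j, s j = 1 ∧ s (h.right⁻¹ i) = -1 := by
    generalize h.right⁻¹ i = j
    fin_cases j
    · exact ⟨![-1, -1, 1], by decide, rfl⟩
    · exact ⟨![-1, -1, 1], by decide, rfl⟩
    · exact ⟨![1, -1, -1], by decide, rfl⟩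
  obtain ⟨g, hg, hgs⟩ := hG.surj s hs
  obtain ⟨s', -, hgs'⟩ := hG.le_max _ ((Subgroup.mem_normalizer_iff.1 hh g).1 hg)
  have hcomm : h * g * h⁻¹ * h = h * g := inv_mul_cancel_right _ _
  generalize h * g * h⁻¹ = g' at hgs' hcomm
  have hi : g'.left i * h.left i = h.left i * g.left (h.right⁻¹ i) := by
    have := congrFun (congrArg SemidirectProduct.left hcomm) i
    rw [SemidirectProduct.mul_left, SemidirectProduct.mul_left, hgs'.perm, map_one] at this
    exact this
  have htwist : (g'.left i).right = -1 := by
    have := congrArg SemidirectProduct.right hi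
    rw [SemidirectProduct.mul_right, SemidirectProduct.mul_right, hgs.twist, hsi,
      ← (signMatrix_commute _ _).eq] at this
    exact mul_right_cancel this
  have hshift : (g'.left i).left.toAdd - (h.left i).left.toAdd = (h.left i).left.toAdd +
      torusAct (h.left i).right (g.left (h.right⁻¹ i)).left.toAdd := by
    have : (g'.left i).left.toAdd + torusAct (g'.left i).right (h.left i).left.toAdd =
        (h.left i).left.toAdd +
          torusAct (h.left i).right (g.left (h.right⁻¹ i)).left.toAdd :=
      congrArg (fun a : A => a.left.toAdd) hi
    rwa [htwist, torusAct_neg_one, ← sub_eq_add_neg] at this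
  have h1 := hgs'.shift i
  have h2 := two_nsmul_torusAct (γ := (h.left i).right) (hgs.shift (h.right⁻¹ i))
  generalize torusAct (h.left i).right _ = u at h2 hshift
  generalize (h.left i).left.toAdd = t at hshift ⊢
  generalize (g'.left i).left.toAdd = v at hshift h1
  calc (4 : ℕ) • t = (2 : ℕ) • v - (2 : ℕ) • u - (2 : ℕ) • (v - t - (t + u)) := by module
    _ = 0 := by rw [h1, h2, hshift]; simp

theorem finite_torus_torsion {n : ℕ} (hn : 0 < n) : Finite {t : Torus // n • t = 0} := by
  refine Set.Finite.subset ((AddCircle.finite_torsion (1 : ℝ) hn).prod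
    (AddCircle.finite_torsion (1 : ℝ) hn)) fun t (ht : n • t = 0) => ?_
  exact ⟨congrArg Prod.fst ht, congrArg Prod.snd ht⟩

theorem inv_mul_mem_range_sanovA3 {h h' : A3} (hr : h.right = h'.right)
    (hl : ∀ i, (h.left i).left = (h'.left i).left)
    (hlr : ∀ i, (h.left i).right⁻¹ * (h'.left i).right ∈ sanovHom.range) :
    h⁻¹ * h' ∈ sanovA3.range := by
  choose w hw using hlr
  -- Left multiplication by `h` permutes the tuple by `h.right`; the reindexing cancels this.
  refine ⟨fun i => w (h.right i), ?_⟩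
  rw [eq_inv_mul_iff_mul_eq, sanovA3_apply]
  ext1
  · rw [SemidirectProduct.mul_left, SemidirectProduct.left_inl]
    funext i
    change h.left i * SemidirectProduct.inr (sanovHom (w (h.right (h.right⁻¹ i)))) = h'.left i
    rw [show h.right (h.right⁻¹ i) = i from h.right.apply_symm_apply i, hw]
    ext1
    · simp [hl]
    · simp
  · rw [SemidirectProduct.mul_right, SemidirectProduct.right_inl, mul_one, hr]

/-- The product of three Sanov subgroups as a subgroup of the normalizer. -/
def sanovNormalizer {G : Subgroup A3} (hG : IsOrbifoldGroup G) :
    (Fin 3 → FreeGroup (Fin 2)) →* H G :=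
  sanovA3.codRestrict (H G) (sanovA3_mem_normalizer hG)

/-- A coset is determined by the permutation, the 4-torsion translations and the Sanov cosets of the
matrices: finitely many data. -/
theorem finiteIndex_range_sanovNormalizer {G : Subgroup A3} (hG : IsOrbifoldGroup G) :
    (sanovNormalizer hG).range.FiniteIndex := by
  have := finite_torus_torsion (n := 4) (by norm_num)
  have := finiteIndex_range_sanovHom
  let f (h : H G) : Equiv.Perm (Fin 3) × (Fin 3 → {t : Torus // (4 : ℕ) • t = 0}) ×
      (Fin 3 → SpecialLinearGroup (Fin 2) ℤ ⧸ sanovHom.range) :=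
    ⟨h.1.right, fun i => ⟨_, four_nsmul_eq_zero_of_mem_normalizer hG h.2 i⟩,
      fun i => (h.1.left i).right⟩
  have hf (h h' : H G) (hh : f h = f h') : h⁻¹ * h' ∈ (sanovNormalizer hG).range := by
    simp only [f, Prod.mk.injEq] at hh
    obtain ⟨w, hw⟩ := inv_mul_mem_range_sanovA3 hh.1
      (fun i => congrArg Subtype.val (congrFun hh.2.1 i))
      (fun i => QuotientGroup.eq.1 (congrFun hh.2.2 i))
    exact ⟨w, Subtype.ext hw⟩
  have : Finite (H G ⧸ (sanovNormalizer hG).range) := by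
    refine Finite.of_injective (fun q => f q.out) fun q q' hq => ?_
    rw [← QuotientGroup.out_eq' q, ← QuotientGroup.out_eq' q']
    exact QuotientGroup.eq.2 (hf _ _ hq)
  exact Subgroup.finiteIndex_of_finite_quotient

/-- The product of three Sanov subgroups mapped to `H' = H / G`. -/
def sanovH' {G : Subgroup A3} (hG : IsOrbifoldGroup G) : (Fin 3 → FreeGroup (Fin 2)) →* H' G :=
  (QuotientGroup.mk' _).comp (sanovNormalizer hG)

theorem sanovH'_injective {G : Subgroup A3} (hG : IsOrbifoldGroup G) :
    Function.Injective (sanovH' hG) := by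
  rw [injective_iff_map_eq_one]
  intro w hw
  have hwG : sanovA3 w ∈ G := (QuotientGroup.eq_one_iff (sanovNormalizer hG w)).1 hw
  obtain ⟨s, -, hs⟩ := hG.le_max _ hwG
  funext i
  apply sanovHom_injective
  have hi : sanovHom (w i) = signMatrix (s i) := hs.twist i
  rw [Pi.one_apply, map_one, hi, signMatrix, if_pos]
  -- A factor $-I$ is excluded because Sanov matrices have upper left entry $1$ mod $4$.
  by_contra hne
  rw [signMatrix, if_neg hne] at hi
  have := (sanovHom_apply_mod (w i)).1
  simp [hi] at this

theorem finiteIndex_range_sanovH' {G : Subgroup A3} (hG : IsOrbifoldGroup G) :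
    (sanovH' hG).range.FiniteIndex := by
  have := finiteIndex_range_sanovNormalizer hG
  rw [sanovH', MonoidHom.range_comp]
  exact ⟨ne_zero_of_dvd_ne_zero this.index_ne_zero
    (Subgroup.index_map_dvd _ (QuotientGroup.mk'_surjective _))⟩

end ToroidalOrbifold

theorem lemma6p6 (G : Subgroup ToroidalOrbifold.A3) (hG : ToroidalOrbifold.IsOrbifoldGroup G) :
    AddGroup.FG (groupCohomology (Rep.trivial ℤ (ToroidalOrbifold.H' G) ℤ) 2) :=
  ((FinitelyTestedHoms.freeGroup (Fin 2)).pi.of_finiteIndex _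
    (ToroidalOrbifold.sanovH'_injective hG)
    (ToroidalOrbifold.finiteIndex_range_sanovH' hG)).fg_H2
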